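/- Let $d\ge 1$ and $r\ge 0$ be integers, and let $\mathcal M_d$ denote the complex $d\times d$ matrices. To an operator $\mathcal W\in\mathcal M_d^{\otimes (r+1)}$ associate the $r$-linear map $$f_{\mathcal W}\colon \mathcal M_d^{\,r}\to\mathcal M_d,\qquad f_{\mathcal W}(X_1,\dots,X_r)=\operatorname{tr}_{1\dots r}\big[\mathcal W\,(X_1\otimes\dots\otimes X_r\otimes \mathbb 1)\big].$$ Definitions. An $r$-linear map $f\colon\mathcal M_d^{\,r}\to\mathcal M_d$ is *positive* if $f(X_1,\dots,X_r)\ge 0$ whenever $X_1,\dots,X_r\ge 0$; *equivariant* if $f(UX_1U^\dagger,\dots,UX_rU^\dagger)=Uf(X_1,\dots,X_r)U^\dagger$ for all unitary $U$ and all $X_i\in\mathcal M_d$; *optimal* if it is positive and the smallest eigenvalue of $f(\tilde X_1,\dots,\tilde X_r)$ is $0$ for some nonzero $\tilde X_1,\dots,\tilde X_r\ge 0$; *completely copositive* if its linear extension $X_1\otimes\dots\otimes X_r\mapsto f(X_1,\dots,X_r)$ to $\mathcal M_d^{\otimes r}$, composed with the transpose, is completely positive. A state is a positive semidefinite operator of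 trace one; a state is *separable* if it is a convex combination of product states, and *entangled* otherwise. An operator $\mathcal W\in\mathcal M_d^{\otimes (r+1)}$ is *unitary-invariant* if $\mathcal W=U^{\otimes (r+1)}\mathcal W (U^\dagger)^{\otimes (r+1)}$ for all unitary $U$; *block-positive* if $\operatorname{tr}[\mathcal W\rho]\ge 0$ for all separable states $\rho$; an *optimal Werner-state witness* if it is unitary-invariant, block-positive, $\operatorname{tr}[\mathcal W\sigma]<0$ for some entangled unitary-invariant state $\sigma$, and $\operatorname{tr}[\mathcal W\tilde\rho]=0$ for some separable state $\tilde\rho$. Then: 1. $\mathcal W\mapsto f_{\mathcal W}$ is a bijection from the unitary-invariant block-positive operators $\mathcal W\in\mathcal M_d^{\otimes(r+1)}$ onto the equivariant positive $r$-linear maps $\mathcal M_d^{\,r}\to\mathcal M_d$. 2. It restricts to a bijection from those unitary-invariant block-positive operators with $\operatorname{tr}[\mathcal W\tilde\rho]=0$ for some separable state $\tilde\rho$ onto the optimal equivariant $r$-linear maps. 3. It restricts to a bijection from the optimal Werner-state witnesses onto the optimal equivariant $r$-linear maps that are not completely copositive. -/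

import Mathlib

open scoped ComplexOrder Matrix

noncomputable section

/-- The complex `d × d` matrices. -/
abbrev Mat (d : ℕ) : Type := Matrix (Fin d) (Fin d) ℂ

/-- The operators on the `n`-fold tensor power of `ℂ^d`, as matrices in the product basis, whose
elements are indexed by the functions `Fin n → Fin d`. -/
abbrev TensorMat (d n : ℕ) : Type := Matrix (Fin n → Fin d) (Fin n → Fin d) ℂ

/-- The tensor (Kronecker) product `A₁ ⊗ ⋯ ⊗ Aₙ`. -/
def tensorProd {d n : ℕ} (A : Fin n → Mat d) : TensorMat d n :=
  Matrix.of fun p q => ∏ k, A k (p k) (q k)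

/-- The partial trace over all tensor factors but the last one. -/
def partialTraceInit {d r : ℕ} (M : TensorMat d (r + 1)) : Mat d :=
  Matrix.of fun a b => ∑ p : Fin r → Fin d,
    M (Fin.snoc (α := fun _ => Fin d) p a) (Fin.snoc (α := fun _ => Fin d) p b)

/-- The operator `X₁ ⊗ ⋯ ⊗ X_r ⊗ 1`. -/
def tensorOne {d r : ℕ} (X : Fin r → Mat d) : TensorMat d (r + 1) :=
  tensorProd (Fin.snoc (α := fun _ => Mat d) X 1)

theorem tensorProd_update_add {d n : ℕ} (A : Fin n → Mat d) (i : Fin n) (x y : Mat d) :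
    tensorProd (Function.update A i (x + y)) =
      tensorProd (Function.update A i x) + tensorProd (Function.update A i y) := by
  ext p q
  have h : ∀ z : Mat d, ∏ k, Function.update A i z k (p k) (q k) =
      z (p i) (q i) * ∏ k ∈ Finset.univ.erase i, A k (p k) (q k) := by
    intro z
    rw [← Finset.mul_prod_erase Finset.univ _ (Finset.mem_univ i)]
    simp only [Function.update_self]
    congr 1
    refine Finset.prod_congr rfl fun k hk => ?_
    rw [Function.update_of_ne (Finset.ne_of_mem_erase hk)]
  simp only [tensorProd, Matrix.of_apply, Matrix.add_apply, h, add_mul]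

theorem tensorProd_update_smul {d n : ℕ} (A : Fin n → Mat d) (i : Fin n) (c : ℂ) (x : Mat d) :
    tensorProd (Function.update A i (c • x)) = c • tensorProd (Function.update A i x) := by
  ext p q
  have h : ∀ z : Mat d, ∏ k, Function.update A i z k (p k) (q k) =
      z (p i) (q i) * ∏ k ∈ Finset.univ.erase i, A k (p k) (q k) := by
    intro z
    rw [← Finset.mul_prod_erase Finset.univ _ (Finset.mem_univ i)]
    simp only [Function.update_self]
    congr 1
    refine Finset.prod_congr rfl fun k hk => ?_
    rw [Function.update_of_ne (Finset.ne_of_mem_erase hk)]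
  simp only [tensorProd, Matrix.of_apply, Matrix.smul_apply, h, smul_eq_mul, mul_assoc]

theorem partialTraceInit_add {d r : ℕ} (M N : TensorMat d (r + 1)) :
    partialTraceInit (M + N) = partialTraceInit M + partialTraceInit N := by
  ext a b
  simp [partialTraceInit, Finset.sum_add_distrib]

theorem partialTraceInit_smul {d r : ℕ} (c : ℂ) (M : TensorMat d (r + 1)) :
    partialTraceInit (c • M) = c • partialTraceInit M := by
  ext a b
  simp [partialTraceInit, Finset.mul_sum]

/-- The `r`-linear map `f_W (X₁, …, X_r) = tr_{1…r} [W (X₁ ⊗ ⋯ ⊗ X_r ⊗ 1)]` of an operator `W` on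
the `(r+1)`-fold tensor power. -/
def mapOfOperator {d r : ℕ} (W : TensorMat d (r + 1)) :
    MultilinearMap ℂ (fun _ : Fin r => Mat d) (Mat d) :=
  MultilinearMap.mk' (fun X => partialTraceInit (W * tensorOne X))
    (fun X i x y => by
      simp only [tensorOne, Fin.snoc_update, tensorProd_update_add, mul_add, partialTraceInit_add])
    (fun X i c x => by
      simp only [tensorOne, Fin.snoc_update, tensorProd_update_smul, Matrix.mul_smul,
        partialTraceInit_smul])

/-- Density matrices. -/
def IsState {ι : Type} [Fintype ι] (ρ : Matrix ι ι ℂ) : Prop :=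
  ρ.PosSemidef ∧ ρ.trace = 1

/-- Separable states: finite convex combinations of product states. -/
def IsSeparableState {d n : ℕ} (ρ : TensorMat d n) : Prop :=
  ∃ (m : ℕ) (p : Fin m → ℝ) (σ : Fin m → Fin n → Mat d),
    (∀ i, 0 ≤ p i) ∧ ∑ i, p i = 1 ∧ (∀ i k, IsState (σ i k)) ∧
      ρ = ∑ i, (p i : ℂ) • tensorProd (σ i)

/-- Entangled states: states that are not separable. -/
def IsEntangledState {d n : ℕ} (ρ : TensorMat d n) : Prop :=
  IsState ρ ∧ ¬ IsSeparableState ρ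

/-- Invariance under the diagonal unitary action, `W = U^{⊗n} W (U†)^{⊗n}` for all unitary `U`. -/
def IsUnitaryInvariant {d n : ℕ} (W : TensorMat d n) : Prop :=
  ∀ U ∈ Matrix.unitaryGroup (Fin d) ℂ,
    W = tensorProd (fun _ => U) * W * tensorProd (fun _ => Uᴴ)

/-- Werner states: states that are invariant under the diagonal unitary action. -/
def IsWernerState {d n : ℕ} (ρ : TensorMat d n) : Prop :=
  IsState ρ ∧ IsUnitaryInvariant ρ

/-- Block-positivity: `tr (W ρ)` is real and nonnegative for all separable states `ρ`. -/
def IsBlockPositive {d n : ℕ} (W : TensorMat d n) : Prop :=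
  ∀ ρ : TensorMat d n, IsSeparableState ρ → 0 ≤ (W * ρ).trace

/-- `W` attains the value zero on the set of separable states. -/
def VanishesOnSeparable {d n : ℕ} (W : TensorMat d n) : Prop :=
  ∃ ρ : TensorMat d n, IsSeparableState ρ ∧ (W * ρ).trace = 0

/-- Werner-state witnesses: unitary-invariant entanglement witnesses that detect some entangled
Werner state. -/
def IsWernerWitness {d n : ℕ} (W : TensorMat d n) : Prop :=
  IsUnitaryInvariant W ∧ IsBlockPositive W ∧
    ∃ σ : TensorMat d n, IsWernerState σ ∧ IsEntangledState σ ∧ (W * σ).trace < 0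

/-- Optimal Werner-state witnesses. -/
def IsOptimalWernerWitness {d n : ℕ} (W : TensorMat d n) : Prop :=
  IsWernerWitness W ∧ VanishesOnSeparable W

/-- Positive multilinear maps: positive semidefinite on positive semidefinite arguments. -/
def IsPositiveMap {d r : ℕ} (f : MultilinearMap ℂ (fun _ : Fin r => Mat d) (Mat d)) : Prop :=
  ∀ X : Fin r → Mat d, (∀ i, (X i).PosSemidef) → (f X).PosSemidef

/-- Equivariance under simultaneous unitary conjugation. -/
def IsEquivariantMap {d r : ℕ} (f : MultilinearMap ℂ (fun _ : Fin r => Mat d) (Mat d)) : Prop :=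
  ∀ U ∈ Matrix.unitaryGroup (Fin d) ℂ, ∀ X : Fin r → Mat d,
    f (fun i => U * X i * Uᴴ) = U * f X * Uᴴ

/-- Optimal multilinear maps: positive, and with smallest eigenvalue `0` at some nonzero positive
semidefinite matrices `X₁, …, X_r`. -/
def IsOptimalMap {d r : ℕ} (f : MultilinearMap ℂ (fun _ : Fin r => Mat d) (Mat d)) : Prop :=
  IsPositiveMap f ∧
    ∃ X : Fin r → Mat d, (∀ i, (X i).PosSemidef ∧ X i ≠ 0) ∧ IsLeast (spectrum ℝ (f X)) 0

/-- The ampliation `Λ ⊗ id_m`, on block matrices. -/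
def ampliation {ι κ : Type} (Λ : Matrix ι ι ℂ →ₗ[ℂ] Matrix κ κ ℂ) (m : ℕ)
    (M : Matrix (ι × Fin m) (ι × Fin m) ℂ) : Matrix (κ × Fin m) (κ × Fin m) ℂ :=
  Matrix.of fun a b => Λ (Matrix.of fun i j => M (i, a.2) (j, b.2)) a.1 b.1

/-- Completely positive linear maps between matrix spaces. -/
def IsCompletelyPositiveMap {ι κ : Type} [Fintype ι] [Fintype κ]
    (Λ : Matrix ι ι ℂ →ₗ[ℂ] Matrix κ κ ℂ) : Prop :=
  ∀ (m : ℕ) (M : Matrix (ι × Fin m) (ι × Fin m) ℂ), M.PosSemidef → (ampliation Λ m M).PosSemidef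

/-- Completely copositive linear maps: `Λ ∘ θ` is completely positive, with `θ` the transpose. -/
def IsCompletelyCopositiveLinear {ι κ : Type} [Fintype ι] [Fintype κ]
    (Λ : Matrix ι ι ℂ →ₗ[ℂ] Matrix κ κ ℂ) : Prop :=
  IsCompletelyPositiveMap (Λ ∘ₗ (Matrix.transposeLinearEquiv ι ι ℂ ℂ).toLinearMap)

/-- An `r`-linear map is completely copositive if its (unique) linear extension
`X₁ ⊗ ⋯ ⊗ X_r ↦ f (X₁, …, X_r)` to the operators on the `r`-fold tensor power is so. -/
def IsCompletelyCopositive {d r : ℕ}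
    (f : MultilinearMap ℂ (fun _ : Fin r => Mat d) (Mat d)) : Prop :=
  ∃ Λ : TensorMat d r →ₗ[ℂ] Mat d,
    (∀ X : Fin r → Mat d, Λ (tensorProd X) = f X) ∧ IsCompletelyCopositiveLinear Λ

end

/-!
The assignment `W ↦ f_W` is a bijection from all operators onto all `r`-linear maps, because the
entries of `W` are the entries of the values of `f_W` at matrix units (`mapOfOperator_injective`,
`mapOfOperator_surjective`). It remains to match the properties of `W` with those of `f_W`.

Most of this rests on the identity `tr [W (X₁ ⊗ ⋯ ⊗ X_r ⊗ Y)] = tr [f_W (X₁, …, X_r) Y]`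
(`trace_mul_tensorProd_snoc`):
* unitary invariance corresponds to equivariance (`isEquivariantMap_mapOfOperator_iff`);
* block-positivity corresponds to positivity, since the positive semidefinite cone is self-dual
  (`isPositiveMap_mapOfOperator_iff`);
* given block-positivity, vanishing on a separable state is vanishing on a product state
  `X₁ ⊗ ⋯ ⊗ X_r ⊗ Y`, which means that the positive semidefinite matrix `f_W (X₁, …, X_r)` is
  singular (`isOptimalMap_mapOfOperator_iff`).

For the last equivalence, `W` is the Choi matrix of the linear extension of `f_W` composed with the
transpose, so `f_W` is completely copositive iff `W` is positive semidefinite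
(`isCompletelyCopositive_mapOfOperator_iff`). A unitary-invariant block-positive `W` is a
Werner-state witness iff it is not positive semidefinite (`isWernerWitness_iff`). Averaging over
the unitary group is not needed: the normalised negative part of `W` is a state detected by `W`, and
it is unitary-invariant because it commutes with everything that commutes with `W`.
-/

/-! ### Positive semidefinite matrices and the trace form -/

open scoped MatrixOrder in
theorem Matrix.PosSemidef.exists_conjTranspose_mul_self {ι : Type} [Fintype ι]
    {M : Matrix ι ι ℂ} (hM : M.PosSemidef) : ∃ B : Matrix ι ι ℂ, M = Bᴴ * B := by
  classical
  exact CStarAlgebra.nonneg_iff_eq_star_mul_self.mp hM.nonneg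

theorem Matrix.PosSemidef.trace_mul_nonneg {ι : Type} [Fintype ι] {M N : Matrix ι ι ℂ}
    (hM : M.PosSemidef) (hN : N.PosSemidef) : 0 ≤ (M * N).trace := by
  obtain ⟨A, rfl⟩ := hM.exists_conjTranspose_mul_self
  rw [Matrix.mul_assoc, Matrix.trace_mul_comm]
  exact (hN.mul_mul_conjTranspose_same A).trace_nonneg

theorem Matrix.PosSemidef.mul_eq_zero_of_trace {ι : Type} [Fintype ι] {M N : Matrix ι ι ℂ}
    (hM : M.PosSemidef) (hN : N.PosSemidef) (h : (M * N).trace = 0) : M * N = 0 := by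
  obtain ⟨A, rfl⟩ := hM.exists_conjTranspose_mul_self
  obtain ⟨B, rfl⟩ := hN.exists_conjTranspose_mul_self
  have h1 : (A * Bᴴ) * (A * Bᴴ)ᴴ = A * (Bᴴ * B) * Aᴴ := by
    simp only [Matrix.conjTranspose_mul, Matrix.conjTranspose_conjTranspose, Matrix.mul_assoc]
  rw [Matrix.mul_assoc, Matrix.trace_mul_comm, ← h1,
    Matrix.trace_mul_conjTranspose_self_eq_zero_iff] at h
  rw [Matrix.mul_assoc, ← Matrix.mul_assoc A, h, Matrix.zero_mul, Matrix.mul_zero]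

open scoped MatrixOrder Matrix.Norms.L2Operator in
theorem span_posSemidef_eq_top (d : ℕ) :
    Submodule.span ℂ {X : Mat d | X.PosSemidef} = ⊤ := by
  simpa only [Matrix.nonneg_iff_posSemidef] using CStarAlgebra.span_nonneg (A := Mat d)

/-- The positive semidefinite cone is self-dual. Hermiticity of `M` comes for free, because the
trace form is determined by its values on the cone, which spans all matrices. -/
theorem posSemidef_of_forall_trace_mul_nonneg {d : ℕ} {M : Mat d}
    (h : ∀ Y : Mat d, Y.PosSemidef → 0 ≤ (M * Y).trace) : M.PosSemidef := by
  refine Matrix.PosSemidef.of_dotProduct_mulVec_nonneg ?_ fun x => ?_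
  · rw [Matrix.IsHermitian, Matrix.ext_iff_trace_mul_right]
    have key : (Matrix.traceLinearMap (Fin d) ℂ ℂ) ∘ₗ LinearMap.mulLeft ℂ Mᴴ =
        (Matrix.traceLinearMap (Fin d) ℂ ℂ) ∘ₗ LinearMap.mulLeft ℂ M := by
      refine LinearMap.ext_on (span_posSemidef_eq_top d) fun Y hY => ?_
      change (Mᴴ * Y).trace = (M * Y).trace
      have h1 : Mᴴ * Y = (Y * M)ᴴ := by
        rw [Matrix.conjTranspose_mul, (show Y.PosSemidef from hY).isHermitian.eq]
      rw [h1, Matrix.trace_conjTranspose, Matrix.trace_mul_comm]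
      exact (IsSelfAdjoint.of_nonneg (h Y hY)).star_eq
    exact fun Y => LinearMap.congr_fun key Y
  · have := h _ (Matrix.posSemidef_vecMulVec_self_star x)
    rwa [Matrix.mul_vecMulVec, Matrix.trace_vecMulVec, dotProduct_comm] at this

theorem exists_pos_smul_isState {ι : Type} [Fintype ι] {M : Matrix ι ι ℂ} (hM : M.PosSemidef)
    (h0 : M ≠ 0) : ∃ (t : ℝ) (S : Matrix ι ι ℂ), 0 < t ∧ IsState S ∧ M = (t : ℂ) • S := by
  have h1 : M.trace ≠ 0 := fun h => h0 (hM.trace_eq_zero_iff.mp h)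
  have h2 : 0 < M.trace := lt_of_le_of_ne hM.trace_nonneg h1.symm
  obtain ⟨t, ht⟩ : ∃ t : ℝ, (t : ℂ) = M.trace :=
    ⟨M.trace.re, (Complex.eq_re_of_ofReal_le (r := 0) (by simpa using h2.le)).symm⟩
  have ht0 : 0 < t := by rw [← ht] at h2; exact_mod_cast h2
  have htc : (t : ℂ) ≠ 0 := ht ▸ h1
  refine ⟨t, ((t⁻¹ : ℝ) : ℂ) • M, ht0, ⟨hM.smul ?_, ?_⟩, ?_⟩
  · exact_mod_cast (inv_pos.mpr ht0).le
  · rw [Matrix.trace_smul, ← ht]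
    simp [htc]
  · rw [smul_smul]
    simp [htc]

theorem IsState.ne_zero {ι : Type} [Fintype ι] {S : Matrix ι ι ℂ} (hS : IsState S) : S ≠ 0 := by
  rintro rfl
  simpa using hS.2

open scoped MatrixOrder in
/-- A positive semidefinite matrix has smallest eigenvalue `0` exactly when it has expectation `0`
in some state: a kernel vector gives such a state, and an invertible matrix allows none. -/
theorem isLeast_spectrum_zero_iff {ι : Type} [Fintype ι] [DecidableEq ι] {M : Matrix ι ι ℂ}
    (hM : M.PosSemidef) :
    IsLeast (spectrum ℝ M) 0 ↔ ∃ S, IsState S ∧ (M * S).trace = 0 := by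
  constructor
  · intro h
    have h1 : M.det = 0 := by
      by_contra hdet
      exact spectrum.zero_notMem ℝ ((Matrix.isUnit_iff_isUnit_det M).mpr (IsUnit.mk0 _ hdet)) h.1
    obtain ⟨v, hv, hMv⟩ := Matrix.exists_mulVec_eq_zero_iff.mpr h1
    have hne : Matrix.vecMulVec v (star v) ≠ 0 := by
      intro h
      rw [Matrix.vecMulVec_eq_zero, star_eq_zero] at h
      tauto
    obtain ⟨t, S, ht, hS, hvS⟩ :=
      exists_pos_smul_isState (Matrix.posSemidef_vecMulVec_self_star v) hne
    refine ⟨S, hS, ?_⟩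
    have h2 : (t : ℂ) * (M * S).trace = 0 := by
      rw [← smul_eq_mul, ← Matrix.trace_smul, ← Matrix.mul_smul, ← hvS, Matrix.mul_vecMulVec, hMv]
      simp
    exact (mul_eq_zero.mp h2).resolve_left (by exact_mod_cast ht.ne')
  · rintro ⟨S, hS, h⟩
    refine ⟨(spectrum.zero_mem_iff ℝ).mpr fun hu => hS.ne_zero ?_,
      fun x hx => spectrum_nonneg_of_nonneg hM.nonneg hx⟩
    exact (hu.mul_right_eq_zero).mp (hM.mul_eq_zero_of_trace hS.1 h)

/-! ### Products of tensor operators -/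

theorem tensorProd_mul {d n : ℕ} (A B : Fin n → Mat d) :
    tensorProd A * tensorProd B = tensorProd (fun k => A k * B k) := by
  ext p q
  simp only [tensorProd, Matrix.mul_apply, Matrix.of_apply, ← Finset.prod_mul_distrib,
    Fintype.prod_sum]

theorem tensorProd_one {d n : ℕ} : tensorProd (fun _ : Fin n => (1 : Mat d)) = 1 := by
  ext p q
  simp only [tensorProd, Matrix.of_apply, Matrix.one_apply, Finset.prod_ite_zero,
    Finset.mem_univ, true_implies, Finset.prod_const_one, funext_iff]

theorem tensorProd_smul {d n : ℕ} (c : Fin n → ℂ) (A : Fin n → Mat d) :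
    tensorProd (fun k => c k • A k) = (∏ k, c k) • tensorProd A := by
  ext p q
  simp [tensorProd, Finset.prod_mul_distrib]

theorem tensorProd_eq_zero {d n : ℕ} {A : Fin n → Mat d} {k : Fin n} (hk : A k = 0) :
    tensorProd A = 0 := by
  ext p q
  exact Finset.prod_eq_zero (Finset.mem_univ k) (by simp [hk])

/-! ### The operator of a multilinear map -/

theorem sum_snoc {d r : ℕ} {E : Type*} [AddCommMonoid E] (g : (Fin (r + 1) → Fin d) → E) :
    ∑ P, g P = ∑ a, ∑ p : Fin r → Fin d, g (Fin.snoc (α := fun _ => Fin d) p a) := by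
  rw [← (Fin.snocEquiv fun _ => Fin d).sum_comp, Fintype.sum_prod_type]
  rfl

theorem tensorOne_snoc {d r : ℕ} (X : Fin r → Mat d) (p q : Fin r → Fin d) (a b : Fin d) :
    tensorOne X (Fin.snoc (α := fun _ => Fin d) p a) (Fin.snoc (α := fun _ => Fin d) q b) =
      (∏ i, X i (p i) (q i)) * (1 : Mat d) a b := by
  simp only [tensorOne, tensorProd, Matrix.of_apply, Fin.prod_univ_castSucc, Fin.snoc_castSucc,
    Fin.snoc_last]
  rw [Fin.snoc_last, Fin.snoc_last]

theorem mapOfOperator_apply {d r : ℕ} (W : TensorMat d (r + 1)) (X : Fin r → Mat d)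
    (a b : Fin d) :
    mapOfOperator W X a b = ∑ p : Fin r → Fin d, ∑ q : Fin r → Fin d,
      W (Fin.snoc (α := fun _ => Fin d) p a) (Fin.snoc (α := fun _ => Fin d) q b) *
        ∏ i, X i (q i) (p i) := by
  change ∑ p : Fin r → Fin d, (W * tensorOne X) (Fin.snoc (α := fun _ => Fin d) p a)
    (Fin.snoc (α := fun _ => Fin d) p b) = _
  refine Finset.sum_congr rfl fun p _ => ?_
  rw [Matrix.mul_apply, sum_snoc, Finset.sum_comm]
  refine Finset.sum_congr rfl fun q _ => ?_
  simp_rw [tensorOne_snoc]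
  rw [Finset.sum_eq_single b]
  · rw [Matrix.one_apply_eq, mul_one]
  · intro c _ hc
    rw [Matrix.one_apply_ne hc, mul_zero, mul_zero]
  · exact fun hb => absurd (Finset.mem_univ b) hb

/-- `tr [W (X₁ ⊗ ⋯ ⊗ X_r ⊗ Y)] = tr [f_W (X₁, …, X_r) Y]`. -/
theorem trace_mul_tensorProd_snoc {d r : ℕ} (W : TensorMat d (r + 1)) (X : Fin r → Mat d)
    (Y : Mat d) :
    (W * tensorProd (Fin.snoc (α := fun _ => Mat d) X Y)).trace =
      (mapOfOperator W X * Y).trace := by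
  simp only [Matrix.trace, Matrix.diag, Matrix.mul_apply, sum_snoc, tensorProd, Matrix.of_apply,
    Fin.prod_univ_castSucc, Fin.snoc_castSucc, Fin.snoc_last, mapOfOperator_apply, Finset.sum_mul]
  refine Finset.sum_congr rfl fun a _ => ?_
  rw [Finset.sum_comm]
  simp only [mul_assoc]

theorem trace_mul_tensorProd {d r : ℕ} (W : TensorMat d (r + 1)) (A : Fin (r + 1) → Mat d) :
    (W * tensorProd A).trace =
      (mapOfOperator W (fun i => A i.castSucc) * A (Fin.last r)).trace := by
  rw [← trace_mul_tensorProd_snoc]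
  congr 3
  exact (Fin.snoc_init_self A).symm

/-- Evaluating `f_W` at matrix units recovers the entries of `W`. -/
theorem mapOfOperator_single {d r : ℕ} (W : TensorMat d (r + 1)) (p q : Fin r → Fin d)
    (a b : Fin d) :
    mapOfOperator W (fun i => Matrix.single (q i) (p i) 1) a b =
      W (Fin.snoc (α := fun _ => Fin d) p a) (Fin.snoc (α := fun _ => Fin d) q b) := by
  rw [mapOfOperator_apply, Finset.sum_eq_single p, Finset.sum_eq_single q]
  · simp
  · intro q' _ hq
    obtain ⟨i, hi⟩ := Function.ne_iff.mp hq
    rw [Finset.prod_eq_zero (Finset.mem_univ i), mul_zero]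
    simp [hi.symm]
  · simp
  · intro p' _ hp
    obtain ⟨i, hi⟩ := Function.ne_iff.mp hp
    refine Finset.sum_eq_zero fun q' _ => ?_
    rw [Finset.prod_eq_zero (Finset.mem_univ i), mul_zero]
    simp [hi.symm]
  · simp

theorem mapOfOperator_injective {d r : ℕ} :
    Function.Injective (mapOfOperator (d := d) (r := r)) := by
  intro W V h
  ext P Q
  rw [← Fin.snoc_init_self P, ← Fin.snoc_init_self Q]
  have := mapOfOperator_single W (Fin.init P) (Fin.init Q) (P (Fin.last r)) (Q (Fin.last r))
  rw [h, mapOfOperator_single] at this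
  exact this.symm

theorem mapOfOperator_surjective {d r : ℕ} :
    Function.Surjective (mapOfOperator (d := d) (r := r)) := by
  intro f
  refine ⟨Matrix.of fun P Q => f (fun i => Matrix.single (Q i.castSucc) (P i.castSucc) 1)
    (P (Fin.last r)) (Q (Fin.last r)), ?_⟩
  -- Both sides agree on tuples of matrix units.
  refine Module.Basis.ext_multilinear (fun _ => Matrix.stdBasis ℂ (Fin d) (Fin d)) fun v => ?_
  have hv : (fun i => Matrix.stdBasis ℂ (Fin d) (Fin d) (v i)) =
      fun i => Matrix.single (v i).1 (v i).2 1 :=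
    funext fun i => Matrix.stdBasis_eq_single ℂ (v i).1 (v i).2
  rw [hv]
  ext a b
  rw [mapOfOperator_single _ (fun i => (v i).2) (fun i => (v i).1)]
  simp only [Matrix.of_apply, Fin.snoc_castSucc, Fin.snoc_last]

/-! ### Block-positivity and vanishing on separable states -/

theorem isSeparableState_tensorProd {d n : ℕ} {S : Fin n → Mat d} (hS : ∀ k, IsState (S k)) :
    IsSeparableState (tensorProd S) :=
  ⟨1, fun _ => 1, fun _ => S, by simp, by simp, fun _ => hS, by simp⟩

theorem trace_mul_sum_smul_tensorProd {d n m : ℕ} (W : TensorMat d n) (p : Fin m → ℝ)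
    (σ : Fin m → Fin n → Mat d) :
    (W * ∑ i, (p i : ℂ) • tensorProd (σ i)).trace =
      ∑ i, (p i : ℂ) * (W * tensorProd (σ i)).trace := by
  simp [Matrix.mul_sum, Matrix.trace_sum]

theorem IsBlockPositive.trace_mul_tensorProd_nonneg {d n : ℕ} {W : TensorMat d n}
    (hW : IsBlockPositive W) {A : Fin n → Mat d} (hA : ∀ k, (A k).PosSemidef) :
    0 ≤ (W * tensorProd A).trace := by
  by_cases h0 : ∃ k, A k = 0
  · obtain ⟨k, hk⟩ := h0
    rw [tensorProd_eq_zero hk]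
    simp
  · push Not at h0
    choose t S ht hS hAS using fun k => exists_pos_smul_isState (hA k) (h0 k)
    rw [funext hAS, tensorProd_smul, Matrix.mul_smul, Matrix.trace_smul, smul_eq_mul]
    refine mul_nonneg (Finset.prod_nonneg fun k _ => ?_) (hW _ (isSeparableState_tensorProd hS))
    exact_mod_cast (ht k).le

theorem snoc_posSemidef {d r : ℕ} {X : Fin r → Mat d} {Y : Mat d} (hX : ∀ i, (X i).PosSemidef)
    (hY : Y.PosSemidef) (k : Fin (r + 1)) :
    (Fin.snoc (α := fun _ => Mat d) X Y k : Mat d).PosSemidef := by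
  induction k using Fin.lastCases with
  | last => rwa [Fin.snoc_last]
  | cast i => rw [Fin.snoc_castSucc]; exact hX i

/-- Both sides say that `tr [W (X₁ ⊗ ⋯ ⊗ X_r ⊗ Y)]` is nonnegative for all positive semidefinite
arguments, the left one by self-duality of the positive semidefinite cone. -/
theorem isPositiveMap_mapOfOperator_iff {d r : ℕ} {W : TensorMat d (r + 1)} :
    IsPositiveMap (mapOfOperator W) ↔ IsBlockPositive W := by
  constructor
  · rintro h ρ ⟨m, p, σ, hp, -, hσ, rfl⟩
    rw [trace_mul_sum_smul_tensorProd]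
    refine Finset.sum_nonneg fun i _ => mul_nonneg (by exact_mod_cast hp i) ?_
    rw [trace_mul_tensorProd]
    exact (h _ fun j => (hσ i _).1).trace_mul_nonneg (hσ i _).1
  · intro h X hX
    refine posSemidef_of_forall_trace_mul_nonneg fun Y hY => ?_
    rw [← trace_mul_tensorProd_snoc]
    exact h.trace_mul_tensorProd_nonneg (snoc_posSemidef hX hY)

/-- A nonnegative function that averages to zero vanishes somewhere, so a block-positive operator
vanishing on a separable state vanishes on a product state. -/
theorem IsBlockPositive.vanishesOnSeparable_iff {d n : ℕ} {W : TensorMat d n}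
    (hW : IsBlockPositive W) :
    VanishesOnSeparable W ↔
      ∃ S : Fin n → Mat d, (∀ k, IsState (S k)) ∧ (W * tensorProd S).trace = 0 := by
  constructor
  · rintro ⟨ρ, ⟨m, p, σ, hp, hp1, hσ, rfl⟩, h⟩
    rw [trace_mul_sum_smul_tensorProd, Finset.sum_eq_zero_iff_of_nonneg fun i _ =>
      mul_nonneg (by exact_mod_cast hp i) (hW _ (isSeparableState_tensorProd (hσ i)))] at h
    obtain ⟨i, -, hi⟩ := Finset.exists_ne_zero_of_sum_ne_zero (hp1.trans_ne one_ne_zero)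
    exact ⟨σ i, hσ i, (mul_eq_zero.mp (h i (Finset.mem_univ i))).resolve_left
      (by exact_mod_cast hi)⟩
  · rintro ⟨S, hS, h⟩
    exact ⟨_, isSeparableState_tensorProd hS, h⟩

/-- A product state `X₁ ⊗ ⋯ ⊗ X_r ⊗ Y` with `tr [f_W (X) Y] = 0` is the same as a smallest
eigenvalue `0` of `f_W (X)`. -/
theorem isOptimalMap_mapOfOperator_iff {d r : ℕ} {W : TensorMat d (r + 1)} :
    IsOptimalMap (mapOfOperator W) ↔ IsBlockPositive W ∧ VanishesOnSeparable W := by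
  rw [IsOptimalMap, isPositiveMap_mapOfOperator_iff]
  refine and_congr_right fun hW => ?_
  have hpos := isPositiveMap_mapOfOperator_iff.mpr hW
  rw [hW.vanishesOnSeparable_iff]
  constructor
  · rintro ⟨X, hX, h⟩
    obtain ⟨Y, hY, hYtr⟩ := (isLeast_spectrum_zero_iff (hpos X fun i => (hX i).1)).mp h
    choose t S ht hS hXS using fun i => exists_pos_smul_isState (hX i).1 (hX i).2
    refine ⟨Fin.snoc (α := fun _ => Mat d) S Y, fun k => ?_, ?_⟩
    · induction k using Fin.lastCases with
      | last => rwa [Fin.snoc_last]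
      | cast i => rw [Fin.snoc_castSucc]; exact hS i
    · rw [trace_mul_tensorProd_snoc]
      rw [funext hXS, MultilinearMap.map_smul_univ, Matrix.smul_mul, Matrix.trace_smul,
        smul_eq_mul] at hYtr
      refine (mul_eq_zero.mp hYtr).resolve_left (Finset.prod_ne_zero_iff.mpr fun i _ => ?_)
      exact_mod_cast (ht i).ne'
  · rintro ⟨S, hS, h⟩
    rw [trace_mul_tensorProd] at h
    refine ⟨fun i => S i.castSucc, fun i => ⟨(hS _).1, (hS _).ne_zero⟩, ?_⟩
    exact (isLeast_spectrum_zero_iff (hpos _ fun i => (hS _).1)).mpr ⟨_, hS _, h⟩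

/-! ### Unitary invariance and equivariance -/

/-- Conjugating `W` by `U^{⊗(r+1)}` conjugates the arguments and the value of `f_W`; for the value
this is the cyclicity of the trace in the last tensor factor. -/
theorem mapOfOperator_conj {d r : ℕ} (W : TensorMat d (r + 1)) (U V : Mat d)
    (X : Fin r → Mat d) :
    mapOfOperator (tensorProd (fun _ => U) * W * tensorProd (fun _ => V)) X =
      U * mapOfOperator W (fun i => V * X i * U) * V := by
  rw [Matrix.ext_iff_trace_mul_right]
  intro Y
  have h1 : tensorProd (fun _ => V) * tensorProd (Fin.snoc (α := fun _ => Mat d) X Y) *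
      tensorProd (fun _ => U) =
      tensorProd (Fin.snoc (α := fun _ => Mat d) (fun i => V * X i * U) (V * Y * U)) := by
    rw [tensorProd_mul, tensorProd_mul]
    congr 1
    funext k
    induction k using Fin.lastCases with
    | last => simp only [Fin.snoc_last]
    | cast i => simp only [Fin.snoc_castSucc]
  rw [← trace_mul_tensorProd_snoc, Matrix.mul_assoc, Matrix.mul_assoc, Matrix.trace_mul_comm,
    Matrix.mul_assoc, h1, trace_mul_tensorProd_snoc, ← Matrix.mul_assoc, Matrix.trace_mul_comm]
  simp only [Matrix.mul_assoc]

theorem isEquivariantMap_mapOfOperator_iff {d r : ℕ} {W : TensorMat d (r + 1)} :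
    IsEquivariantMap (mapOfOperator W) ↔ IsUnitaryInvariant W := by
  refine forall₂_congr fun U hU => ?_
  have hU1 : Uᴴ * U = 1 := Matrix.mem_unitaryGroup_iff'.mp hU
  have hU2 : U * Uᴴ = 1 := Matrix.mem_unitaryGroup_iff.mp hU
  constructor
  · intro h
    refine mapOfOperator_injective (MultilinearMap.ext fun X => ?_)
    rw [mapOfOperator_conj, ← h]
    congr 1
    funext i
    rw [← Matrix.mul_assoc, ← Matrix.mul_assoc, hU2, Matrix.one_mul, Matrix.mul_assoc, hU2,
      Matrix.mul_one]
  · intro h X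
    conv_lhs => rw [h]
    rw [mapOfOperator_conj]
    congr 3
    funext i
    rw [← Matrix.mul_assoc, ← Matrix.mul_assoc, hU1, Matrix.one_mul, Matrix.mul_assoc, hU1,
      Matrix.mul_one]

/-! ### Complete copositivity and positive semidefiniteness of the operator -/

/-- The linear extension `Y ↦ tr_{1…r} [W (Y ⊗ 1)]` of `mapOfOperator W`, given in the product
basis, where the factor `1` removes the sum over the last index. -/
noncomputable def linearMapOfOperator {d r : ℕ} (W : TensorMat d (r + 1)) :
    TensorMat d r →ₗ[ℂ] Mat d where
  toFun Y := Matrix.of fun a b => ∑ p : Fin r → Fin d, ∑ q : Fin r → Fin d,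
    W (Fin.snoc (α := fun _ => Fin d) p a) (Fin.snoc (α := fun _ => Fin d) q b) * Y q p
  map_add' Y Z := by
    ext a b
    simp [mul_add, Finset.sum_add_distrib]
  map_smul' c Y := by
    ext a b
    simp [Finset.mul_sum, mul_left_comm]

theorem linearMapOfOperator_tensorProd {d r : ℕ} (W : TensorMat d (r + 1)) (X : Fin r → Mat d) :
    linearMapOfOperator W (tensorProd X) = mapOfOperator W X := by
  ext a b
  rw [mapOfOperator_apply]
  rfl

/-- Compression by `1 ⊗ u`, where `u` is the vector of ones, preserves positive semidefiniteness. -/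
theorem Matrix.PosSemidef.sum_snd {ι κ : Type} [Fintype ι] [Fintype κ] [DecidableEq κ]
    {H : Matrix (κ × ι) (κ × ι) ℂ} (hH : H.PosSemidef) :
    (Matrix.of fun a b => ∑ p, ∑ q, H (a, p) (b, q)).PosSemidef := by
  convert hH.conjTranspose_mul_mul_same
    (Matrix.of fun (x : κ × ι) (a : κ) => if x.1 = a then (1 : ℂ) else 0) using 1
  ext a b
  simp only [Matrix.of_apply, Matrix.mul_apply, Matrix.conjTranspose_apply, apply_ite star,
    star_one, star_zero, ite_mul, one_mul, zero_mul, mul_ite, mul_one, mul_zero,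
    Fintype.sum_prod_type_right, Finset.sum_ite_eq', Finset.mem_univ, if_true]
  exact Finset.sum_comm

open scoped Kronecker in
/-- If `W` is positive semidefinite, then the block matrices of `(Λ ∘ θ) ⊗ id` arise from a
principal submatrix of the Kronecker product of `W` with the argument by summing over an index. -/
theorem isCompletelyCopositiveLinear_of_posSemidef {d r : ℕ} {W : TensorMat d (r + 1)}
    (hW : W.PosSemidef) : IsCompletelyCopositiveLinear (linearMapOfOperator W) := fun _ _ hM =>
  ((hW.kronecker hM).submatrix fun x : (Fin d × Fin _) × (Fin r → Fin d) =>
    (Fin.snoc (α := fun _ => Fin d) x.2 x.1.1, (x.2, x.1.2))).sum_snd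

theorem tensorProd_single {d n : ℕ} (p q : Fin n → Fin d) :
    tensorProd (fun k => Matrix.single (p k) (q k) 1) = Matrix.single p q 1 := by
  ext p' q'
  simp only [tensorProd, Matrix.of_apply, Matrix.single_apply, Finset.prod_ite_zero,
    Finset.mem_univ, true_implies, Finset.prod_const_one, funext_iff, forall_and]

/-- The operator `W` is the Choi matrix of `Λ ∘ θ`, with `Λ` the linear extension of
`mapOfOperator W`. -/
theorem isCompletelyCopositive_mapOfOperator_iff {d r : ℕ} {W : TensorMat d (r + 1)} :
    IsCompletelyCopositive (mapOfOperator W) ↔ W.PosSemidef := by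
  constructor
  · rintro ⟨Λ, hΛ, hcp⟩
    let e := Fintype.equivFin (Fin r → Fin d)
    -- The unnormalised maximally entangled vector.
    let v : (Fin r → Fin d) × Fin (Fintype.card (Fin r → Fin d)) → ℂ :=
      fun x => if x.1 = e.symm x.2 then 1 else 0
    have h := (hcp _ _ (Matrix.posSemidef_vecMulVec_self_star v)).submatrix
      fun P : Fin (r + 1) → Fin d => (P (Fin.last r), e (Fin.init P))
    convert h using 1
    ext P Q
    have hM : (Matrix.of fun i j => Matrix.vecMulVec v (star v)
        (i, e (Fin.init P)) (j, e (Fin.init Q)))ᵀ =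
        tensorProd fun i => Matrix.single (Fin.init Q i) (Fin.init P i) 1 := by
      rw [tensorProd_single]
      ext i j
      simp only [Matrix.transpose_apply, Matrix.of_apply, Matrix.vecMulVec_apply, v,
        Pi.star_apply, Equiv.symm_apply_apply, Matrix.single_apply, apply_ite star, star_one,
        star_zero, mul_ite, mul_one, mul_zero, ← ite_and]
      simp only [eq_comm]
    change W P Q = Λ (Matrix.of fun i j => Matrix.vecMulVec v (star v)
        (i, e (Fin.init P)) (j, e (Fin.init Q)))ᵀ (P (Fin.last r)) (Q (Fin.last r))
    rw [hM, hΛ, mapOfOperator_single W (Fin.init P) (Fin.init Q), Fin.snoc_init_self,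
      Fin.snoc_init_self]
  · exact fun hW => ⟨_, linearMapOfOperator_tensorProd W,
      isCompletelyCopositiveLinear_of_posSemidef hW⟩

/-! ### Detected Werner states -/

/-- The operators `W` and `Wᴴ` define the same multilinear map on tuples of positive semidefinite
matrices, and these span. -/
theorem IsBlockPositive.isHermitian {d r : ℕ} {W : TensorMat d (r + 1)} (hW : IsBlockPositive W) :
    W.IsHermitian := by
  apply mapOfOperator_injective
  refine MultilinearMap.ext_of_span_eq_top
    (γ := fun _ => {X : Mat d // X.PosSemidef}) (g := fun _ X => X.1) (fun _ => ?_) fun X => ?_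
  · rw [Subtype.range_coe_subtype, span_posSemidef_eq_top]
  · rw [← (isPositiveMap_mapOfOperator_iff.mpr hW _ fun i => (X i).2).isHermitian.eq]
    ext a b
    rw [Matrix.conjTranspose_apply, mapOfOperator_apply, mapOfOperator_apply, Finset.sum_comm,
      star_sum]
    refine Finset.sum_congr rfl fun p _ => ?_
    rw [star_sum]
    refine Finset.sum_congr rfl fun q _ => ?_
    rw [Matrix.conjTranspose_apply, star_mul', star_prod]
    congr 1
    exact Finset.prod_congr rfl fun i _ => ((X i).2.isHermitian.apply _ _).symm

open scoped MatrixOrder in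
/-- The negative part of a Hermitian matrix `W` that is not positive semidefinite witnesses this
against the trace form. It is a function of `W`, hence shares all symmetries of `W`. -/
theorem exists_posSemidef_trace_mul_neg {ι : Type} [Fintype ι] [DecidableEq ι]
    {W : Matrix ι ι ℂ} (hW : W.IsHermitian) (h : ¬ W.PosSemidef) :
    ∃ N : Matrix ι ι ℂ, N.PosSemidef ∧ N ≠ 0 ∧ (W * N).trace < 0 ∧
      ∀ T, Commute W T → Commute N T := by
  have hc : ∀ f : ℝ → ℝ, ContinuousOn f (spectrum ℝ W) := fun f =>
    W.finite_real_spectrum.continuousOn f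
  have hsa : IsSelfAdjoint W := hW
  set N : Matrix ι ι ℂ := cfc (fun x : ℝ => max (-x) 0) W with hN
  have hNpos : N.PosSemidef :=
    Matrix.nonneg_iff_posSemidef.mp (cfc_nonneg fun x _ => le_max_right _ _)
  have hWN : W * N = -(N * N) := by
    conv_lhs => rw [← cfc_id' ℝ W, hN]
    rw [← cfc_mul _ _ W (hc _) (hc _), ← cfc_mul _ _ W (hc _) (hc _), ← cfc_neg]
    congr 1
    funext x
    rcases le_total x 0 with hx | hx
    · rw [max_eq_left (by linarith)]; ring
    · rw [max_eq_right (by linarith)]; ring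
  have hN0 : N ≠ 0 := by
    intro h0
    apply h
    have h1 : W + N = cfc (fun x : ℝ => x + max (-x) 0) W := by
      rw [cfc_add _ _ _ (hc _) (hc _), cfc_id' ℝ W]
    rw [h0, add_zero] at h1
    rw [h1, ← Matrix.nonneg_iff_posSemidef]
    exact cfc_nonneg fun x _ => by linarith [le_max_left (-x) 0]
  refine ⟨N, hNpos, hN0, ?_, fun T hT => hT.cfc_real _⟩
  rw [hWN, Matrix.trace_neg, neg_lt_zero]
  refine lt_of_le_of_ne (hNpos.trace_mul_nonneg hNpos) fun h0 => hN0 ?_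
  have := Matrix.trace_mul_conjTranspose_self_eq_zero_iff (A := N)
  rw [hNpos.isHermitian.eq] at this
  exact this.mp h0.symm

theorem isUnitaryInvariant_iff_commute {d n : ℕ} {W : TensorMat d n} :
    IsUnitaryInvariant W ↔
      ∀ U ∈ Matrix.unitaryGroup (Fin d) ℂ, Commute W (tensorProd fun _ => U) := by
  refine forall₂_congr fun U hU => ?_
  have hU1 : tensorProd (fun _ : Fin n => Uᴴ) * tensorProd (fun _ => U) = 1 := by
    rw [tensorProd_mul, ← tensorProd_one, ← Matrix.star_eq_conjTranspose,
      Matrix.mem_unitaryGroup_iff'.mp hU]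
  have hU2 : tensorProd (fun _ : Fin n => U) * tensorProd (fun _ => Uᴴ) = 1 := by
    rw [tensorProd_mul, ← tensorProd_one, ← Matrix.star_eq_conjTranspose,
      Matrix.mem_unitaryGroup_iff.mp hU]
  constructor
  · intro h
    rw [Commute, SemiconjBy]
    nth_rw 1 [h]
    rw [Matrix.mul_assoc, hU1, Matrix.mul_one]
  · intro h
    rw [← h.eq, Matrix.mul_assoc, hU2, Matrix.mul_one]

/-- A state detected by `W` exists iff `W` is not positive semidefinite. It can be chosen
invariant: the normalised negative part of `W` serves. It is entangled because `W` is
block-positive. -/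
theorem isWernerWitness_iff {d r : ℕ} {W : TensorMat d (r + 1)} :
    IsWernerWitness W ↔ IsUnitaryInvariant W ∧ IsBlockPositive W ∧ ¬ W.PosSemidef := by
  refine and_congr_right fun hinv => and_congr_right fun hbp => ?_
  constructor
  · rintro ⟨σ, ⟨hσ, -⟩, -, hneg⟩ hW
    exact hneg.not_ge (hW.trace_mul_nonneg hσ.1)
  · intro hW
    obtain ⟨N, hN, hN0, hneg, hcomm⟩ := exists_posSemidef_trace_mul_neg hbp.isHermitian hW
    obtain ⟨t, σ, ht, hσ, hNσ⟩ := exists_pos_smul_isState hN hN0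
    have htc : (0 : ℂ) < t := by exact_mod_cast ht
    have hσN : σ = (t : ℂ)⁻¹ • N := by rw [hNσ, smul_smul, inv_mul_cancel₀ htc.ne', one_smul]
    have hneg' : (W * σ).trace < 0 := by
      rw [hσN, Matrix.mul_smul, Matrix.trace_smul, smul_eq_mul]
      exact mul_neg_of_pos_of_neg (inv_pos.mpr htc) hneg
    refine ⟨σ, ⟨hσ, isUnitaryInvariant_iff_commute.mpr fun U hU => ?_⟩,
      ⟨hσ, fun hsep => hneg'.not_ge (hbp σ hsep)⟩, hneg'⟩
    rw [hσN]
    exact (hcomm _ (isUnitaryInvariant_iff_commute.mp hinv U hU)).smul_left _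

/-! ### The correspondence -/

theorem bijOn_mapOfOperator {d r : ℕ} {s : Set (TensorMat d (r + 1))}
    {t : Set (MultilinearMap ℂ (fun _ : Fin r => Mat d) (Mat d))}
    (h : ∀ W, mapOfOperator W ∈ t ↔ W ∈ s) : Set.BijOn (mapOfOperator (d := d) (r := r)) s t := by
  refine ⟨fun W hW => (h W).mpr hW, mapOfOperator_injective.injOn, fun f hf => ?_⟩
  obtain ⟨W, rfl⟩ := mapOfOperator_surjective f
  exact ⟨W, (h W).mp hf, rfl⟩

theorem mainTheorem8 (d r : ℕ) (hd : 1 ≤ d) :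
    Set.BijOn (mapOfOperator (d := d) (r := r))
        {W | IsUnitaryInvariant W ∧ IsBlockPositive W}
        {f | IsPositiveMap f ∧ IsEquivariantMap f} ∧
      Set.BijOn (mapOfOperator (d := d) (r := r))
        {W | IsUnitaryInvariant W ∧ IsBlockPositive W ∧ VanishesOnSeparable W}
        {f | IsOptimalMap f ∧ IsEquivariantMap f} ∧
      Set.BijOn (mapOfOperator (d := d) (r := r))
        {W | IsOptimalWernerWitness W}
        {f | IsOptimalMap f ∧ IsEquivariantMap f ∧ ¬ IsCompletelyCopositive f} := by
  refine ⟨bijOn_mapOfOperator fun W => ?_, bijOn_mapOfOperator fun W => ?_,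
    bijOn_mapOfOperator fun W => ?_⟩
  · simp only [Set.mem_ofPred_eq, isPositiveMap_mapOfOperator_iff,
      isEquivariantMap_mapOfOperator_iff]
    tauto
  · simp only [Set.mem_ofPred_eq, isOptimalMap_mapOfOperator_iff,
      isEquivariantMap_mapOfOperator_iff]
    tauto
  · simp only [Set.mem_ofPred_eq, isOptimalMap_mapOfOperator_iff,
      isEquivariantMap_mapOfOperator_iff, isCompletelyCopositive_mapOfOperator_iff,
      IsOptimalWernerWitness, isWernerWitness_iff]
    tauto
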